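/- For $n\ge 3$ let $B_n=\mathrm{Cay}(S_n,S)$ be the bubble-sort graph of dimension $n$, where $S=\{(1\,2),(2\,3),\dots,(n{-}1\;n)\}$: its vertices are the permutations of $\{1,\dots,n\}$, and $x$ is adjacent to $sx$ for every $s\in S$. An $r$-distinguishing labelling of a graph $G$ is a map from its vertices to $\{1,\dots,r\}$ that is preserved by no non-identity automorphism of $G$, and the distinguishing number $D(G)$ is the least $r$ for which one exists. Let $T(S)$ be the graph on $\{1,\dots,n\}$ in which $i,j$ are adjacent if and only if $(i\,j)\in S$ (a path). Theorem. For every $n\ge 3$: (1) $D(B_n)=2$. (2) If $n\ge 4$, the labelling of the vertices of $B_n$ that gives label $1$ to the cycles $(1\,2),(1\,2\,3),\dots,(1\,2\cdots n)$ and label $2$ to all other permutations is $2$-distinguishing. (3) $\mathrm{Aut}(B_n)$ is the direct product of the right regular representation of $S_n$ and $\mathrm{Aut}(T(S))$ acting by left multiplication: assigning to $(a,b)\in S_n\times\mathrm{Aut}(T(S))$ the map $x\mapsto b\,x\,a^{-1}$ is a group isomorphism $S_n\times \mathrm{Aut}(T(S))\to \mathrm{Aut}(B_n)$. -/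

import Mathlib

/-- The Cayley graph `Cay(H, S)`: every `h` is joined to `s * h` for `s ∈ S`
(loops, which would come from `1 ∈ S`, are dropped). -/
def cayleyGraph {H : Type*} [Group H] (S : Set H) : SimpleGraph H :=
  SimpleGraph.fromRel (fun g h => ∃ s ∈ S, h = s * g)

/-- `φ` is an `r`-distinguishing labelling of the vertices of `G`: its labels lie in `{1, …, r}` and
every non-identity automorphism of `G` changes the label of some vertex. -/
def IsDistinguishingLabelling {V : Type*} (G : SimpleGraph V) (r : ℕ) (φ : V → ℕ) : Prop :=
  (∀ x, φ x ∈ Finset.Icc 1 r) ∧ ∀ σ : G ≃g G, σ ≠ 1 → ∃ x, φ x ≠ φ (σ x)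

/-- The distinguishing number `D(G)`: the least `r` for which `G` has an `r`-distinguishing
labelling. (For a finite graph such an `r` exists.) -/
noncomputable def distinguishingNumber {V : Type*} (G : SimpleGraph V) : ℕ :=
  sInf {r : ℕ | ∃ φ : V → ℕ, IsDistinguishingLabelling G r φ}

/-- The adjacent transpositions `(1 2), (2 3), …, (n-1 n)`; the points `1, …, n` are
the elements `0, …, n - 1` of `Fin n`. -/
def adjacentTranspositions (n : ℕ) : Set (Equiv.Perm (Fin n)) :=
  {s | ∃ i j : Fin n, (i : ℕ) + 1 = (j : ℕ) ∧ s = Equiv.swap i j}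

/-- The transposition graph `T(S)` of a set `S` of transpositions. -/
def transpositionGraph {n : ℕ} (S : Set (Equiv.Perm (Fin n))) : SimpleGraph (Fin n) :=
  SimpleGraph.fromRel (fun i j => Equiv.swap i j ∈ S)

/-- The bubble-sort graph `B_n`. -/
def bubbleSortGraph (n : ℕ) : SimpleGraph (Equiv.Perm (Fin n)) :=
  cayleyGraph (adjacentTranspositions n)

/-- Label `1` on the cycles `(1 2), (1 2 3), …, (1 2 ⋯ n)`, label `2` on all other permutations.
Here `Fin.cycleRange i` is the cycle `0 ↦ 1 ↦ ⋯ ↦ i ↦ 0` fixing all points above `i`. -/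
def bubbleSortLabelling (n : ℕ) (x : Equiv.Perm (Fin n)) : ℕ :=
  if ∃ i : Fin n, 1 ≤ (i : ℕ) ∧ x = Fin.cycleRange i then 1 else 2

/-!
Write `sᵢ` for the `i`-th adjacent transposition. An automorphism `σ` of the bubble-sort graph sends
the edge from `x` to `sᵢ x` to an edge from `σ x` to `sⱼ (σ x)`, which defines a permutation
`i ↦ j` of the generators at each vertex `x`. Two distinct generators commute exactly when their
edges at `x` lie on a common 4-cycle, so this permutation is an automorphism of the path on the
generators, that is, the identity or the reversal. Both ends of an edge agree on the generator of
that edge, which decides between the two choices unless it is the middle generator `sᵢ`; in that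
case the hexagon through `x`, `sᵢ x` and `sᵢ₋₁ x` does. Hence the permutation is the same at all
vertices, so `σ` is `x ↦ b x a⁻¹` with `b` trivial or the order-reversing permutation.

If such a map preserves the set of the cycles `cᵢ = (1 2 ⋯ i+1)`, one looks at the inverses of the
cycles: `cᵢ⁻¹` sends the first point to the `i+1`-st and every later point to itself or to its
predecessor. Comparing where a few points go then shows that `a` and `b` are trivial.
-/

open Equiv Equiv.Perm SimpleGraph

section Labelling

variable {V : Type*} {G : SimpleGraph V}

theorem isDistinguishingLabelling_ite {P : V → Prop} [DecidablePred P]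
    (h : ∀ σ : G ≃g G, (∀ x, P x ↔ P (σ x)) → σ = 1) :
    IsDistinguishingLabelling G 2 fun x => if P x then 1 else 2 := by
  refine ⟨fun x => ?_, fun σ hσ => ?_⟩
  · dsimp only
    split_ifs <;> simp
  · contrapose! hσ
    refine h σ fun x => ?_
    have hx := hσ x
    split_ifs at hx <;> simp_all

theorem IsDistinguishingLabelling.two_le [Nontrivial (G ≃g G)] {r : ℕ} {φ : V → ℕ}
    (h : IsDistinguishingLabelling G r φ) : 2 ≤ r := by
  obtain ⟨σ, hσ⟩ := exists_ne (1 : G ≃g G)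
  obtain ⟨x, hx⟩ := h.2 σ hσ
  have hx₁ := Finset.mem_Icc.1 (h.1 x)
  have hx₂ := Finset.mem_Icc.1 (h.1 (σ x))
  omega

theorem distinguishingNumber_eq_two [Nontrivial (G ≃g G)] {φ : V → ℕ}
    (h : IsDistinguishingLabelling G 2 φ) : distinguishingNumber G = 2 :=
  IsLeast.csInf_eq ⟨⟨φ, h⟩, fun _ ⟨_, hψ⟩ => hψ.two_le⟩

end Labelling

section CayleyGraph

variable {H : Type*} [Group H] {S : Set H}

theorem cayleyGraph_adj {g h : H} :
    (cayleyGraph S).Adj g h ↔ g ≠ h ∧ (h * g⁻¹ ∈ S ∨ g * h⁻¹ ∈ S) := by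
  simp only [cayleyGraph, fromRel_adj, ← mul_inv_eq_iff_eq_mul, exists_eq_right']

/-- The action of `H × N(S)` on the Cayley graph of `S`, where `(a, b)` acts as `x ↦ b x a⁻¹`. -/
def cayleyGraphAction (S : Set H) :
    H × Subgroup.normalizer S →* (cayleyGraph S ≃g cayleyGraph S) where
  toFun p :=
    { toEquiv := (Equiv.mulLeft (p.2 : H)).trans (Equiv.mulRight p.1⁻¹)
      map_rel_iff' := by
        intro g h
        have key (g h : H) :
            p.2 * h * p.1⁻¹ * (p.2 * g * p.1⁻¹)⁻¹ = p.2 * (h * g⁻¹) * (p.2 : H)⁻¹ := by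
          group
        simp only [Equiv.trans_apply, Equiv.coe_mulLeft, Equiv.coe_mulRight, cayleyGraph_adj, key,
          ← Subgroup.mem_set_normalizer_iff.1 p.2.2 _, ne_eq, mul_left_inj, mul_right_inj] }
  map_one' := RelIso.ext fun x => show (1 : H) * x * 1⁻¹ = x by simp
  map_mul' p q := RelIso.ext fun x =>
    show (p.2 * q.2 : H) * x * (p.1 * q.1)⁻¹ = p.2 * (q.2 * x * q.1⁻¹) * p.1⁻¹ by group

theorem cayleyGraphAction_injective (hH : Subgroup.center H = ⊥) :
    Function.Injective (cayleyGraphAction S) := by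
  rw [injective_iff_map_eq_one]
  rintro ⟨a, b⟩ h
  have hfix (x : H) : (b : H) * x = x * a := mul_inv_eq_iff_eq_mul.1 (DFunLike.congr_fun h x)
  have hba : (b : H) = a := by simpa using hfix 1
  have ha : a = 1 := by
    rw [← Subgroup.mem_bot, ← hH, Subgroup.mem_center_iff]
    exact fun x => by rw [← hfix x, hba]
  exact Prod.ext ha (Subtype.ext (hba.trans ha))

end CayleyGraph

theorem perm_center_eq_bot {α : Type*} (hα : 3 ≤ ENat.card α) :
    Subgroup.center (Perm α) = ⊥ := by
  classical
  refine (Subgroup.eq_bot_iff_forall _).2 fun a ha => Equiv.ext fun i => ?_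
  obtain ⟨j, hji, hja⟩ := ENat.exists_ne_ne_of_three_le hα i (a i)
  by_contra hi
  rw [Perm.one_apply] at hi
  have hcomm := DFunLike.congr_fun (Subgroup.mem_center_iff.1 ha (swap (a i) j)) i
  rw [Perm.mul_apply, Perm.mul_apply, swap_apply_left,
    swap_apply_of_ne_of_ne (Ne.symm hi) hji.symm] at hcomm
  exact hja hcomm

section TranspositionGraph

variable {n : ℕ} {S : Set (Perm (Fin n))}

theorem transpositionGraph_adj (hS : ∀ s ∈ S, s.IsSwap) {i j : Fin n} :
    (transpositionGraph S).Adj i j ↔ swap i j ∈ S := by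
  simp only [transpositionGraph, fromRel_adj, swap_comm j i, or_self]
  exact and_iff_right_of_imp fun h => swap_isSwap_iff.1 (hS _ h)

theorem conj_mem_of_transpositionGraph_iso (hS : ∀ s ∈ S, s.IsSwap)
    (b : transpositionGraph S ≃g transpositionGraph S) {s : Perm (Fin n)} (hs : s ∈ S) :
    b.toEquiv * s * b.toEquiv⁻¹ ∈ S := by
  obtain ⟨i, j, -, rfl⟩ := hS s hs
  rw [← swap_apply_apply]
  exact (transpositionGraph_adj hS).1 (b.map_adj_iff.2 ((transpositionGraph_adj hS).2 hs))

/-- The automorphisms of the transposition graph of a set `S` of transpositions are the permutations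
normalizing `S`. -/
def transpositionGraphAutEquiv (hS : ∀ s ∈ S, s.IsSwap) :
    (transpositionGraph S ≃g transpositionGraph S) ≃* Subgroup.normalizer S where
  toFun b := ⟨b.toEquiv, Subgroup.mem_set_normalizer_iff.2 fun s =>
    ⟨conj_mem_of_transpositionGraph_iso hS b, fun hs => by
      have := conj_mem_of_transpositionGraph_iso hS b⁻¹ hs
      rwa [show (b⁻¹).toEquiv = b.toEquiv⁻¹ from rfl, inv_inv, ← mul_assoc, ← mul_assoc,
        inv_mul_cancel, one_mul, inv_mul_cancel_right] at this⟩⟩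
  invFun b :=
    { toEquiv := b
      map_rel_iff' := by
        intro i j
        rw [transpositionGraph_adj hS, transpositionGraph_adj hS, swap_apply_apply]
        exact (Subgroup.mem_set_normalizer_iff.1 b.2 _).symm }
  left_inv _ := rfl
  right_inv _ := rfl
  map_mul' _ _ := rfl

end TranspositionGraph

section PathGraph

variable {k : ℕ}

theorem pathGraph_adj_rev {i j : Fin k} :
    (pathGraph k).Adj i.rev j.rev ↔ (pathGraph k).Adj i j := by
  simp only [pathGraph_adj, Fin.val_rev]
  omega

theorem strictMono_of_pathGraph_adj {m : ℕ} {p : Fin (k + 2) → Fin m} (hp : Function.Injective p)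
    (hadj : ∀ i j, (pathGraph (k + 2)).Adj i j → (pathGraph m).Adj (p i) (p j))
    (h01 : p 0 < p 1) : StrictMono p := by
  refine Fin.strictMono_iff_lt_succ.2 fun i => ?_
  induction i using Fin.induction with
  | zero => exact h01
  | succ i ih =>
    have hne : (p i.castSucc.castSucc : ℕ) ≠ p i.succ.succ :=
      Fin.val_ne_of_ne
        (hp.ne (Fin.castSucc_lt_succ.trans (Fin.succ_lt_succ_iff.2 Fin.castSucc_lt_succ)).ne)
    have hstep₁ := hadj i.castSucc.castSucc i.castSucc.succ (by simp [pathGraph_adj])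
    have hstep₂ := hadj i.succ.castSucc i.succ.succ (by simp [pathGraph_adj])
    rw [Fin.succ_castSucc] at ih hstep₁
    rw [pathGraph_adj] at hstep₁ hstep₂
    rw [Fin.lt_def] at ih ⊢
    omega

theorem eq_id_or_rev_of_pathGraph_adj {p : Fin k → Fin k} (hp : Function.Injective p)
    (hadj : ∀ i j, (pathGraph k).Adj i j → (pathGraph k).Adj (p i) (p j)) :
    p = id ∨ p = Fin.rev := by
  match k with
  | 0 | 1 => exact Or.inl (Subsingleton.elim _ _)
  | k + 2 =>
    rcases (hp.ne Fin.zero_ne_one).lt_or_gt with h01 | h10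
    · exact Or.inl (strictMono_of_pathGraph_adj hp hadj h01).eq_id
    · right
      have hrev : StrictMono (Fin.rev ∘ p) :=
        strictMono_of_pathGraph_adj (Fin.rev_injective.comp hp)
          (fun i j hij => pathGraph_adj_rev.2 (hadj i j hij)) (Fin.rev_lt_rev.2 h10)
      funext i
      rw [← Fin.rev_rev (p i)]
      exact congrArg Fin.rev (congrFun hrev.eq_id i)

theorem eq_of_apply_eq_of_eq_id_or_rev {p q : Fin k → Fin k} (hp : p = id ∨ p = Fin.rev)
    (hq : q = id ∨ q = Fin.rev) {i : Fin k} (hi : i.rev ≠ i) (h : p i = q i) : p = q := by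
  rcases hp with rfl | rfl <;> rcases hq with rfl | rfl
  · rfl
  · exact absurd h.symm hi
  · exact absurd h hi
  · rfl

theorem exists_pathGraph_adj_rev_ne {i : Fin k} (hi : i.rev = i) (hk : k ≠ 1) :
    ∃ j, (pathGraph k).Adj i j ∧ j.rev ≠ j := by
  rw [Fin.ext_iff, Fin.val_rev] at hi
  refine ⟨⟨i - 1, by omega⟩, pathGraph_adj.2 (Or.inr ?_), Fin.ne_of_val_ne ?_⟩
  · dsimp only
    omega
  · rw [Fin.val_rev]
    dsimp only
    omega

end PathGraph

section AdjSwap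

variable {k : ℕ}

/-- The transposition exchanging the consecutive points `i` and `i + 1` of `Fin (k + 1)`; these are
the generators of the bubble-sort graph, indexed by `Fin k`. -/
def adjSwap (i : Fin k) : Perm (Fin (k + 1)) :=
  swap i.castSucc i.succ

theorem mem_adjacentTranspositions {s : Perm (Fin (k + 1))} :
    s ∈ adjacentTranspositions (k + 1) ↔ ∃ i : Fin k, s = adjSwap i := by
  constructor
  · rintro ⟨i, j, hij, rfl⟩
    have hi : i = (⟨i, by omega⟩ : Fin k).castSucc := rfl
    have hj : j = (⟨i, by omega⟩ : Fin k).succ := Fin.ext hij.symm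
    exact ⟨⟨i, by omega⟩, congrArg₂ swap hi hj⟩
  · rintro ⟨i, rfl⟩
    exact ⟨i.castSucc, i.succ, by simp, rfl⟩

theorem isSwap_of_mem_adjacentTranspositions {n : ℕ} :
    ∀ s ∈ adjacentTranspositions n, s.IsSwap := by
  rintro _ ⟨i, j, hij, rfl⟩
  exact swap_isSwap_iff.2 (Fin.ne_of_val_ne (by omega))

theorem val_adjSwap_apply (i : Fin k) (v : Fin (k + 1)) :
    (adjSwap i v : ℕ) =
      if (v : ℕ) = i then (i : ℕ) + 1 else if (v : ℕ) = i + 1 then (i : ℕ) else v := by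
  simp only [adjSwap, swap_apply_def, Fin.ext_iff, Fin.val_castSucc, Fin.val_succ]
  split_ifs <;> simp

theorem adjSwap_mul_self (i : Fin k) : adjSwap i * adjSwap i = 1 :=
  swap_mul_self _ _

theorem adjSwap_mul_cancel_left (i : Fin k) (x : Perm (Fin (k + 1))) :
    adjSwap i * (adjSwap i * x) = x :=
  swap_mul_self_mul _ _ _

theorem adjSwap_ne_one (i : Fin k) : adjSwap i ≠ 1 :=
  mt swap_eq_one_iff.1 Fin.castSucc_lt_succ.ne

theorem adjSwap_injective : Function.Injective (adjSwap (k := k)) := by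
  intro i j h
  have hi := val_adjSwap_apply i i.castSucc
  rw [h, val_adjSwap_apply] at hi
  ext
  simp only [Fin.val_castSucc] at hi
  split_ifs at hi <;> omega

theorem commute_adjSwap_iff {i j : Fin k} :
    Commute (adjSwap i) (adjSwap j) ↔ ¬(pathGraph k).Adj i j := by
  rw [pathGraph_adj]
  constructor
  · intro h hadj
    have hi := congrArg Fin.val (DFunLike.congr_fun h.eq i.castSucc)
    simp only [Perm.mul_apply, val_adjSwap_apply, Fin.val_castSucc] at hi
    split_ifs at hi <;> omega
  · intro hadj
    ext v
    simp only [Perm.mul_apply, val_adjSwap_apply]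
    split_ifs <;> omega

theorem adjSwap_braid {i j : Fin k} (hij : (pathGraph k).Adj i j) :
    adjSwap i * adjSwap j * adjSwap i = adjSwap j * adjSwap i * adjSwap j := by
  wlog h : (i : ℕ) + 1 = j generalizing i j
  · exact (this hij.symm ((pathGraph_adj.1 hij).resolve_left h)).symm
  have hj : j.castSucc = i.succ := Fin.ext h.symm
  have hlt : i.castSucc < j.succ :=
    Fin.castSucc_lt_succ.trans (hj.symm.trans_lt Fin.castSucc_lt_succ)
  rw [adjSwap, adjSwap, hj, swap_comm i.castSucc, swap_comm i.succ j.succ,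
    swap_mul_swap_mul_swap (hj ▸ Fin.castSucc_lt_succ.ne') hlt.ne', swap_comm i.succ i.castSucc,
    swap_comm j.succ, swap_mul_swap_mul_swap Fin.castSucc_lt_succ.ne hlt.ne, swap_comm]

theorem exists_adjSwap_adjSwap_crossing_iff {i j : Fin k} (hij : i ≠ j) (t : ℕ) :
    (∃ v : Fin (k + 1), (v : ℕ) ≤ t ∧ t < (adjSwap j (adjSwap i v) : ℕ)) ↔ t = i ∨ t = j := by
  have hne : (i : ℕ) ≠ j := Fin.val_ne_of_ne hij
  constructor
  · rintro ⟨v, hv, ht⟩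
    simp only [val_adjSwap_apply] at ht
    split_ifs at ht <;> omega
  · rintro (rfl | rfl)
    · refine ⟨i.castSucc, by simp, ?_⟩
      simp only [val_adjSwap_apply, Fin.val_castSucc]
      split_ifs <;> omega
    · refine ⟨adjSwap i j.castSucc, ?_, ?_⟩
      · simp only [val_adjSwap_apply, Fin.val_castSucc]
        split_ifs <;> omega
      · rw [← Perm.mul_apply (adjSwap i), adjSwap_mul_self]
        simp [val_adjSwap_apply]

theorem eq_or_eq_of_adjSwap_mul_adjSwap_eq {i j a b : Fin k} (hij : i ≠ j) (hab : a ≠ b)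
    (h : adjSwap b * adjSwap a = adjSwap j * adjSwap i) :
    (a = i ∧ b = j) ∨ (a = j ∧ b = i) := by
  have hiff (t : ℕ) : (t = a ∨ t = b) ↔ (t = i ∨ t = j) := by
    rw [← exists_adjSwap_adjSwap_crossing_iff hab, ← exists_adjSwap_adjSwap_crossing_iff hij]
    simp only [← Perm.mul_apply, h]
  have hi := hiff i
  have hj := hiff j
  simp only [ne_eq, Fin.ext_iff] at hab hij ⊢
  omega

theorem val_adjSwap_apply_le (i : Fin k) (v : Fin (k + 1)) :
    (adjSwap i v : ℕ) ≤ v + 1 ∧ (v : ℕ) ≤ adjSwap i v + 1 := by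
  rw [val_adjSwap_apply]
  split_ifs <;> omega

theorem exists_val_apply_eq_add_three {i u v : Fin k} (hu : (pathGraph k).Adj i u)
    (hv : (pathGraph k).Adj i v) (huv : u ≠ v) : ∃ w y : Fin (k + 1),
      adjSwap v (adjSwap i (adjSwap u (adjSwap i w))) = y ∧
        ((y : ℕ) = w + 3 ∨ (w : ℕ) = y + 3) := by
  rw [pathGraph_adj] at hu hv
  rw [ne_eq, Fin.ext_iff] at huv
  rcases hu with hu | hu
  · refine ⟨u.succ, _, rfl, Or.inr ?_⟩
    have h₁ : (adjSwap i u.succ : ℕ) = u + 1 := by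
      rw [val_adjSwap_apply, Fin.val_succ]
      split_ifs <;> omega
    have h₂ : (adjSwap u (adjSwap i u.succ) : ℕ) = u := by
      rw [val_adjSwap_apply, h₁]
      split_ifs <;> omega
    have h₃ : (adjSwap i (adjSwap u (adjSwap i u.succ)) : ℕ) = i := by
      rw [val_adjSwap_apply, h₂]
      split_ifs <;> omega
    rw [val_adjSwap_apply, h₃, Fin.val_succ]
    split_ifs <;> omega
  · refine ⟨u.castSucc, _, rfl, Or.inl ?_⟩
    have h₁ : (adjSwap i u.castSucc : ℕ) = u := by
      rw [val_adjSwap_apply, Fin.val_castSucc]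
      split_ifs <;> omega
    have h₂ : (adjSwap u (adjSwap i u.castSucc) : ℕ) = u + 1 := by
      rw [val_adjSwap_apply, h₁]
      split_ifs <;> omega
    have h₃ : (adjSwap i (adjSwap u (adjSwap i u.castSucc)) : ℕ) = i + 1 := by
      rw [val_adjSwap_apply, h₂, if_pos hu]
    rw [val_adjSwap_apply, h₃, Fin.val_castSucc]
    split_ifs <;> omega

theorem adjSwap_mul_adjSwap_mul_adjSwap_ne {i u v : Fin k} (hu : (pathGraph k).Adj i u)
    (hv : (pathGraph k).Adj i v) (huv : u ≠ v) (a b : Fin k) :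
    adjSwap a * adjSwap i * adjSwap u ≠ adjSwap b * adjSwap v * adjSwap i := by
  intro h
  obtain ⟨w, y, hy, hwy⟩ := exists_val_apply_eq_add_three hu hv huv
  -- The equation gives `s_b s_a = s_v s_i s_u s_i`, but only the right side moves a point by 3.
  have hab : adjSwap a w = adjSwap b y := by
    rw [← hy]
    simpa only [← Perm.mul_apply, mul_assoc, adjSwap_mul_cancel_left, adjSwap_mul_self, mul_one]
      using DFunLike.congr_fun h ((adjSwap u * adjSwap i) w)
  have ha := val_adjSwap_apply_le a w
  have hb := val_adjSwap_apply_le b y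
  rw [hab] at ha
  omega

theorem revPerm_mul_adjSwap_mul_inv (i : Fin k) :
    Fin.revPerm * adjSwap i * Fin.revPerm⁻¹ = adjSwap i.rev := by
  rw [adjSwap, ← swap_apply_apply, Fin.revPerm_apply, Fin.revPerm_apply, Fin.rev_castSucc,
    Fin.rev_succ, swap_comm, adjSwap]

theorem revPerm_mem_normalizer_adjacentTranspositions :
    Fin.revPerm ∈ Subgroup.normalizer (adjacentTranspositions (k + 1)) := by
  have hmem {s : Perm (Fin (k + 1))} (hs : s ∈ adjacentTranspositions (k + 1)) :
      Fin.revPerm * s * Fin.revPerm⁻¹ ∈ adjacentTranspositions (k + 1) := by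
    obtain ⟨i, rfl⟩ := mem_adjacentTranspositions.1 hs
    exact mem_adjacentTranspositions.2 ⟨i.rev, revPerm_mul_adjSwap_mul_inv i⟩
  have hinv : (Fin.revPerm : Perm (Fin (k + 1)))⁻¹ = Fin.revPerm := rfl
  refine Subgroup.mem_set_normalizer_iff.2 fun s => ⟨hmem, fun hs => ?_⟩
  have hconj : Fin.revPerm * (Fin.revPerm * s * Fin.revPerm⁻¹) * Fin.revPerm⁻¹ = s :=
    Equiv.ext fun v => by simp only [hinv, Perm.mul_apply, Fin.revPerm_apply, Fin.rev_rev]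
  exact hconj ▸ hmem hs

theorem adjSwap_induction {motive : Perm (Fin (k + 1)) → Prop} (x : Perm (Fin (k + 1)))
    (one : motive 1) (adjSwap_mul : ∀ i x, motive x → motive (adjSwap i * x)) : motive x := by
  have hx : x ∈ Submonoid.closure (Set.range fun i : Fin k => swap i.castSucc i.succ) :=
    mclosure_swap_castSucc_succ k ▸ Submonoid.mem_top x
  induction hx using Submonoid.closure_induction_left with
  | one => exact one
  | mul_left s hs y _ ih =>
    obtain ⟨i, rfl⟩ := hs
    exact adjSwap_mul i y ih

end AdjSwap

section BubbleSortGraph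

variable {k : ℕ}

theorem bubbleSortGraph_adj {x y : Perm (Fin (k + 1))} :
    (bubbleSortGraph (k + 1)).Adj x y ↔ ∃ i : Fin k, y = adjSwap i * x := by
  simp only [bubbleSortGraph, cayleyGraph_adj, mem_adjacentTranspositions, mul_inv_eq_iff_eq_mul]
  constructor
  · rintro ⟨-, ⟨i, h⟩ | ⟨i, rfl⟩⟩
    · exact ⟨i, h⟩
    · exact ⟨i, (adjSwap_mul_cancel_left i y).symm⟩
  · rintro ⟨i, rfl⟩
    exact ⟨fun h => adjSwap_ne_one i (right_eq_mul.1 h), Or.inl ⟨i, rfl⟩⟩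

variable (σ : bubbleSortGraph (k + 1) ≃g bubbleSortGraph (k + 1)) (x : Perm (Fin (k + 1)))

theorem exists_apply_adjSwap_mul_eq (i : Fin k) : ∃ j, σ (adjSwap i * x) = adjSwap j * σ x :=
  bubbleSortGraph_adj.1 (σ.map_adj_iff.2 (bubbleSortGraph_adj.2 ⟨i, rfl⟩))

/-- The permutation of the generators induced by `σ` at the vertex `x`: the image under `σ` of the
edge from `x` to `adjSwap i * x` leads from `σ x` to `adjSwap (edgeLabel σ x i) * σ x`. -/
noncomputable def edgeLabel (i : Fin k) : Fin k :=
  (exists_apply_adjSwap_mul_eq σ x i).choose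

theorem apply_adjSwap_mul (i : Fin k) : σ (adjSwap i * x) = adjSwap (edgeLabel σ x i) * σ x :=
  (exists_apply_adjSwap_mul_eq σ x i).choose_spec

variable {σ x} in
theorem edgeLabel_eq_iff {i j : Fin k} :
    edgeLabel σ x i = j ↔ σ (adjSwap i * x) = adjSwap j * σ x := by
  rw [apply_adjSwap_mul, mul_left_inj, adjSwap_injective.eq_iff]

theorem edgeLabel_injective : Function.Injective (edgeLabel σ x) := by
  intro i j hij
  rw [edgeLabel_eq_iff, ← apply_adjSwap_mul] at hij
  exact adjSwap_injective (mul_right_cancel (σ.injective hij))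

theorem edgeLabel_symm_edgeLabel (i : Fin k) :
    edgeLabel σ.symm (σ x) (edgeLabel σ x i) = i := by
  rw [edgeLabel_eq_iff, ← apply_adjSwap_mul, σ.symm_apply_apply, σ.symm_apply_apply]

theorem edgeLabel_adjSwap_mul_self (i : Fin k) :
    edgeLabel σ (adjSwap i * x) i = edgeLabel σ x i := by
  rw [edgeLabel_eq_iff, adjSwap_mul_cancel_left, apply_adjSwap_mul, adjSwap_mul_cancel_left]

variable {σ x} in
theorem commute_adjSwap_edgeLabel {i j : Fin k} (h : Commute (adjSwap i) (adjSwap j)) :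
    Commute (adjSwap (edgeLabel σ x i)) (adjSwap (edgeLabel σ x j)) := by
  rcases eq_or_ne i j with rfl | hij
  · exact Commute.refl _
  have hi : edgeLabel σ x i ≠ edgeLabel σ (adjSwap i * x) j := by
    rw [← edgeLabel_adjSwap_mul_self]
    exact (edgeLabel_injective _ _).ne hij
  have hj : edgeLabel σ x j ≠ edgeLabel σ (adjSwap j * x) i := by
    rw [← edgeLabel_adjSwap_mul_self]
    exact (edgeLabel_injective _ _).ne hij.symm
  have hsquare : adjSwap (edgeLabel σ (adjSwap j * x) i) * adjSwap (edgeLabel σ x j) =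
      adjSwap (edgeLabel σ (adjSwap i * x) j) * adjSwap (edgeLabel σ x i) := by
    apply mul_right_cancel (b := σ x)
    rw [mul_assoc, mul_assoc, ← apply_adjSwap_mul, ← apply_adjSwap_mul, ← apply_adjSwap_mul,
      ← apply_adjSwap_mul, ← mul_assoc, ← mul_assoc, h.eq]
  rcases eq_or_eq_of_adjSwap_mul_adjSwap_eq hi hj hsquare with ⟨hji, -⟩ | ⟨h₁, h₂⟩
  · exact absurd (edgeLabel_injective σ x hji).symm hij
  · rw [h₂, ← h₁] at hsquare
    exact hsquare

variable {σ x} in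
theorem pathGraph_adj_edgeLabel {i j : Fin k} (h : (pathGraph k).Adj i j) :
    (pathGraph k).Adj (edgeLabel σ x i) (edgeLabel σ x j) := by
  contrapose h
  rw [← commute_adjSwap_iff] at h ⊢
  simpa only [edgeLabel_symm_edgeLabel] using
    commute_adjSwap_edgeLabel (σ := σ.symm) (x := σ x) h

theorem edgeLabel_eq_id_or_rev : edgeLabel σ x = id ∨ edgeLabel σ x = Fin.rev :=
  eq_id_or_rev_of_pathGraph_adj (edgeLabel_injective σ x) fun _ _ => pathGraph_adj_edgeLabel

theorem edgeLabel_adjSwap_mul_of_rev_ne {i : Fin k} (hi : i.rev ≠ i) :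
    edgeLabel σ (adjSwap i * x) = edgeLabel σ x :=
  eq_of_apply_eq_of_eq_id_or_rev (edgeLabel_eq_id_or_rev _ _) (edgeLabel_eq_id_or_rev _ _) hi
    (edgeLabel_adjSwap_mul_self σ x i)

theorem edgeLabel_adjSwap_mul_apply_of_rev_eq {i j : Fin k} (hi : i.rev = i)
    (hij : (pathGraph k).Adj i j) : edgeLabel σ (adjSwap i * x) j = edgeLabel σ x j := by
  have hfix (y : Perm (Fin (k + 1))) : edgeLabel σ y i = i := by
    rcases edgeLabel_eq_id_or_rev σ y with h | h <;> rw [h]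
    exacts [rfl, hi]
  have hadj (y : Perm (Fin (k + 1))) : (pathGraph k).Adj i (edgeLabel σ y j) := by
    simpa only [hfix] using pathGraph_adj_edgeLabel (σ := σ) (x := y) hij
  by_contra hne
  refine adjSwap_mul_adjSwap_mul_adjSwap_ne (hadj x) (hadj (adjSwap i * x)) (Ne.symm hne)
    (edgeLabel σ (adjSwap i * (adjSwap j * x)) j) (edgeLabel σ (adjSwap j * (adjSwap i * x)) i) ?_
  apply mul_right_cancel (b := σ x)
  have hleft : σ (adjSwap i * (adjSwap j * x)) = adjSwap i * (adjSwap (edgeLabel σ x j) * σ x) := by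
    rw [apply_adjSwap_mul, hfix, apply_adjSwap_mul]
  have hright : σ (adjSwap j * (adjSwap i * x)) =
      adjSwap (edgeLabel σ (adjSwap i * x) j) * (adjSwap i * σ x) := by
    rw [apply_adjSwap_mul, apply_adjSwap_mul, hfix]
  simp only [mul_assoc]
  rw [← hleft, ← hright, ← apply_adjSwap_mul, ← apply_adjSwap_mul]
  simp only [← mul_assoc, adjSwap_braid hij]

theorem edgeLabel_adjSwap_mul (i : Fin k) : edgeLabel σ (adjSwap i * x) = edgeLabel σ x := by
  by_cases hi : i.rev = i
  · by_cases hk : k = 1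
    · subst hk
      exact Subsingleton.elim _ _
    obtain ⟨j, hij, hj⟩ := exists_pathGraph_adj_rev_ne hi hk
    exact eq_of_apply_eq_of_eq_id_or_rev (edgeLabel_eq_id_or_rev _ _)
      (edgeLabel_eq_id_or_rev _ _) hj (edgeLabel_adjSwap_mul_apply_of_rev_eq σ x hi hij)
  · exact edgeLabel_adjSwap_mul_of_rev_ne σ x hi

theorem edgeLabel_eq_edgeLabel_one : edgeLabel σ x = edgeLabel σ 1 := by
  induction x using adjSwap_induction with
  | one => rfl
  | adjSwap_mul i x ih => rw [edgeLabel_adjSwap_mul, ih]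

variable {σ} in
theorem apply_eq_of_edgeLabel_one {b : Perm (Fin (k + 1))}
    (hb : ∀ i, b * adjSwap i * b⁻¹ = adjSwap (edgeLabel σ 1 i)) :
    σ x = b * x * (b⁻¹ * σ 1) := by
  induction x using adjSwap_induction with
  | one => simp
  | adjSwap_mul i x ih =>
    rw [apply_adjSwap_mul, edgeLabel_eq_edgeLabel_one, ← hb, ih]
    group

theorem exists_apply_eq_mul_mul_inv :
    ∃ a b : Perm (Fin (k + 1)), (b = 1 ∨ b = Fin.revPerm) ∧ ∀ x, σ x = b * x * a⁻¹ := by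
  obtain ⟨b, hb, hconj⟩ : ∃ b : Perm (Fin (k + 1)), (b = 1 ∨ b = Fin.revPerm) ∧
      ∀ i, b * adjSwap i * b⁻¹ = adjSwap (edgeLabel σ 1 i) := by
    rcases edgeLabel_eq_id_or_rev σ 1 with h | h
    · exact ⟨1, Or.inl rfl, by simp [h]⟩
    · exact ⟨Fin.revPerm, Or.inr rfl, by simp [h, revPerm_mul_adjSwap_mul_inv]⟩
  refine ⟨(b⁻¹ * σ 1)⁻¹, b, hb, fun x => ?_⟩
  rw [inv_inv]
  exact apply_eq_of_edgeLabel_one x hconj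

theorem cayleyGraphAction_adjacentTranspositions_surjective :
    Function.Surjective (cayleyGraphAction (adjacentTranspositions (k + 1))) := by
  intro σ
  obtain ⟨a, b, hb, hσ⟩ := exists_apply_eq_mul_mul_inv σ
  have hmem : b ∈ Subgroup.normalizer (adjacentTranspositions (k + 1)) := by
    rcases hb with rfl | rfl
    exacts [one_mem _, revPerm_mem_normalizer_adjacentTranspositions]
  exact ⟨(a, ⟨b, hmem⟩), RelIso.ext fun x => (hσ x).symm⟩

end BubbleSortGraph

section BubbleSortLabelling

variable {k : ℕ}

theorem apply_cycleRange_symm_inv_apply {n : ℕ} {a b : Perm (Fin n)} {i j : Fin n}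
    (h : b * i.cycleRange * a⁻¹ = j.cycleRange) (t : Fin n) :
    a (i.cycleRange.symm (b⁻¹ t)) = j.cycleRange.symm t := by
  have hinv : a * i.cycleRange⁻¹ * b⁻¹ = j.cycleRange⁻¹ := by
    rw [← h]
    group
  exact DFunLike.congr_fun hinv t

theorem val_cycleRange_symm_succ {n : ℕ} (i : Fin (n + 1)) (t : Fin n) :
    (i.cycleRange.symm t.succ : ℕ) = if (t : ℕ) < i then (t : ℕ) else t + 1 := by
  rw [Fin.cycleRange_symm_succ]
  split_ifs with h
  · rw [Fin.succAbove_of_castSucc_lt i t h, Fin.val_castSucc]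
  · rw [Fin.succAbove_of_le_castSucc i t (not_lt.1 h), Fin.val_succ]

theorem eq_one_of_cycleRange_mul_inv_eq_cycleRange {a : Perm (Fin (k + 4))}
    (ha : ∀ i : Fin (k + 3), ∃ j : Fin (k + 4), i.succ.cycleRange * a⁻¹ = j.cycleRange) :
    a = 1 := by
  have happly {i j : Fin (k + 4)} (h : i.cycleRange * a⁻¹ = j.cycleRange) (t : Fin (k + 4)) :
      a (i.cycleRange.symm t) = j.cycleRange.symm t :=
    apply_cycleRange_symm_inv_apply (b := 1) (by rwa [one_mul]) t
  obtain ⟨j₁, h₁⟩ := ha 0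
  obtain ⟨j₂, h₂⟩ := ha 1
  obtain ⟨j₃, h₃⟩ := ha 2
  have hle : (a 2 : ℕ) ≤ 2 := by
    have hpt : (Fin.succ 0 : Fin (k + 4)).cycleRange.symm (Fin.succ 1) = 2 := by
      rw [Fin.ext_iff, val_cycleRange_symm_succ]
      rfl
    rw [← hpt, happly h₁, val_cycleRange_symm_succ, Fin.val_one]
    split_ifs <;> omega
  have hge : 2 ≤ (a 2 : ℕ) := by
    have hpt : (Fin.succ 2 : Fin (k + 4)).cycleRange.symm (Fin.succ 2) = 2 := by
      rw [Fin.ext_iff, val_cycleRange_symm_succ]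
      rfl
    rw [← hpt, happly h₃, val_cycleRange_symm_succ, Fin.val_two]
    split_ifs <;> omega
  have hj₂ : a 2 = j₂ := by
    simpa only [Fin.cycleRange_symm_zero, Fin.succ_one_eq_two] using happly h₂ 0
  have hfix : a 2 = 2 := Fin.ext (hle.antisymm hge)
  rwa [← hj₂, hfix, Fin.succ_one_eq_two, mul_eq_left, inv_eq_one] at h₂

theorem exists_revPerm_mul_cycleRange_mul_inv_ne (a : Perm (Fin (k + 4))) :
    ∃ i : Fin (k + 3), ∀ j : Fin (k + 4),
      Fin.revPerm * i.succ.cycleRange * a⁻¹ ≠ j.cycleRange := by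
  by_contra! h
  have hlast {i : Fin (k + 3)} {j : Fin (k + 4)} (hi : (i : ℕ) < k + 2)
      (hij : Fin.revPerm * i.succ.cycleRange * a⁻¹ = j.cycleRange) :
      a (Fin.last (k + 3)) = j := by
    have h0 := apply_cycleRange_symm_inv_apply hij 0
    have hrev : (Fin.revPerm : Perm (Fin (k + 4)))⁻¹ 0 = Fin.last (k + 3) := rfl
    have hfix : i.succ.cycleRange.symm (Fin.last (k + 3)) = Fin.last (k + 3) :=
      (symm_apply_eq _).2 (Fin.cycleRange_of_gt (Nat.succ_lt_succ hi)).symm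
    rwa [Fin.cycleRange_symm_zero, hrev, hfix] at h0
  obtain ⟨j₁, h₁⟩ := h 0
  obtain ⟨j₂, h₂⟩ := h 1
  have hj : j₁ = j₂ := (hlast (by simp) h₁).symm.trans (hlast (by simp) h₂)
  have hcycle : (Fin.succ 0 : Fin (k + 4)).cycleRange = (Fin.succ 1 : Fin (k + 4)).cycleRange := by
    rw [hj, ← h₂] at h₁
    exact mul_left_cancel (mul_right_cancel h₁)
  have h01 := DFunLike.congr_fun (congrArg Equiv.symm hcycle) 0
  rw [Fin.cycleRange_symm_zero, Fin.cycleRange_symm_zero] at h01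
  exact Fin.zero_ne_one (Fin.succ_injective _ h01)

theorem isDistinguishingLabelling_bubbleSortLabelling :
    IsDistinguishingLabelling (bubbleSortGraph (k + 4)) 2 (bubbleSortLabelling (k + 4)) := by
  refine isDistinguishingLabelling_ite fun σ hσ => ?_
  obtain ⟨a, b, hb, hab⟩ := exists_apply_eq_mul_mul_inv σ
  have hcycle (i : Fin (k + 3)) :
      ∃ j : Fin (k + 4), b * i.succ.cycleRange * a⁻¹ = j.cycleRange := by
    obtain ⟨j, -, hj⟩ := (hσ i.succ.cycleRange).1 ⟨i.succ, Nat.succ_pos i, rfl⟩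
    exact ⟨j, (hab _).symm.trans hj⟩
  rcases hb with rfl | rfl
  · have ha : a = 1 :=
      eq_one_of_cycleRange_mul_inv_eq_cycleRange (by simpa only [one_mul] using hcycle)
    refine RelIso.ext fun x => ?_
    rw [hab, ha, one_mul, inv_one, mul_one, RelIso.one_apply]
  · obtain ⟨i, hne⟩ := exists_revPerm_mul_cycleRange_mul_inv_ne a
    obtain ⟨j, hj⟩ := hcycle i
    exact absurd hj (hne j)

-- `1`, `(0 1)`, `(0 2)` are the vertices 0, 1, 3 of a hexagon, which only the identity preserves.
theorem isDistinguishingLabelling_bubbleSortGraph_three :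
    IsDistinguishingLabelling (bubbleSortGraph 3) 2
      fun x => if x = 1 ∨ x = swap 0 1 ∨ x = swap 0 2 then 1 else 2 := by
  refine isDistinguishingLabelling_ite fun σ hσ => ?_
  obtain ⟨a, b, hb, hab⟩ := exists_apply_eq_mul_mul_inv σ
  have hrigid : ∀ a b : Perm (Fin 3), (b = 1 ∨ b = Fin.revPerm) →
      (∀ x, (x = 1 ∨ x = swap 0 1 ∨ x = swap 0 2) ↔
        (b * x * a⁻¹ = 1 ∨ b * x * a⁻¹ = swap 0 1 ∨ b * x * a⁻¹ = swap 0 2)) →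
      ∀ x, b * x * a⁻¹ = x := by
    decide
  exact RelIso.ext fun x => (hab x).trans (hrigid a b hb (fun y => hab y ▸ hσ y) x)

end BubbleSortLabelling

theorem mainTheorem4 (n : ℕ) (hn : 3 ≤ n) :
    distinguishingNumber (bubbleSortGraph n) = 2 ∧
    (4 ≤ n → IsDistinguishingLabelling (bubbleSortGraph n) 2 (bubbleSortLabelling n)) ∧
    ∃ Φ : Equiv.Perm (Fin n) ×
          (transpositionGraph (adjacentTranspositions n) ≃g
            transpositionGraph (adjacentTranspositions n)) ≃*
          (bubbleSortGraph n ≃g bubbleSortGraph n),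
      ∀ (a : Equiv.Perm (Fin n))
        (b : transpositionGraph (adjacentTranspositions n) ≃g
          transpositionGraph (adjacentTranspositions n))
        (x : Equiv.Perm (Fin n)),
        Φ (a, b) x = b.toEquiv * x * a⁻¹ := by
  have hinj : Function.Injective (cayleyGraphAction (adjacentTranspositions n)) :=
    cayleyGraphAction_injective (perm_center_eq_bot (by simpa using hn))
  refine ⟨?_, ?_, ?_⟩
  · have : Nontrivial (bubbleSortGraph n ≃g bubbleSortGraph n) := by
      have : Nontrivial (Fin n) := Fin.nontrivial_iff_two_le.2 (by omega)
      exact hinj.nontrivial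
    obtain rfl | ⟨k, rfl⟩ : n = 3 ∨ ∃ k, n = k + 4 :=
      hn.eq_or_lt.imp Eq.symm fun h => ⟨n - 4, by omega⟩
    · exact distinguishingNumber_eq_two isDistinguishingLabelling_bubbleSortGraph_three
    · exact distinguishingNumber_eq_two isDistinguishingLabelling_bubbleSortLabelling
  · intro h4
    obtain ⟨k, rfl⟩ := Nat.exists_eq_add_of_le' h4
    exact isDistinguishingLabelling_bubbleSortLabelling
  · obtain ⟨k, rfl⟩ := Nat.exists_eq_add_of_le' (Nat.one_le_of_lt hn)
    let e := (MulEquiv.refl (Perm (Fin (k + 1)))).prodCongr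
      (transpositionGraphAutEquiv (isSwap_of_mem_adjacentTranspositions (n := k + 1)))
    exact ⟨e.trans (MulEquiv.ofBijective _
      ⟨hinj, cayleyGraphAction_adjacentTranspositions_surjective⟩), fun _ _ _ => rfl⟩
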